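/- Let $\Gamma_0\subseteq\mathrm{PSL}_2(\mathbb{R})$ be a Fuchsian group of the first kind, i.e. a discrete subgroup such that the quotient $\Gamma_0\backslash\mathbb{H}$ of the upper half-plane $\mathbb{H}$ becomes compact when its cusps are added (equivalently, it has finite hyperbolic area). For a subgroup $\Gamma\subseteq\Gamma_0$ of finite index and an integer $k\geq 1$, let $\mathcal{S}_{2k}^{\Gamma}$ be the space of cusp forms of weight $2k$ for $\Gamma$, that is, of holomorphic functions $f:\mathbb{H}\to\mathbb{C}$ with $f(\gamma z)=(cz+d)^{2k}f(z)$ for all $\gamma=\left(\begin{smallmatrix}a&b\\c&d\end{smallmatrix}\right)\in\Gamma$ that vanish at all the cusps of $\Gamma$, with the Petersson inner product $$\langle f,g\rangle=\int_{\Gamma\backslash\mathbb{H}}f(z)\,\overline{g(z)}\,y^{2k}\,\frac{dx\,dy}{y^2}\qquad(z=x+iy),$$ the integral being taken over any fundamental domain for $\Gamma$. For an orthonormal basis $f_1,\dots,f_d$ of $\mathcal{S}_{2k}^{\Gamma}$ put $$S_k^{\Gamma}(z)=\sum_{j=1}^{d}|f_j(z)|^2\,\mathrm{Im}(z)^{2k}\qquad(z\in\mathbb{H}).$$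 Then there is a constant $C$, depending only on $\Gamma_0$, such that for every subgroup $\Gamma\subseteq\Gamma_0$ of finite index and every integer $k\geq 1$, $$\sup_{z\in\Gamma\backslash\mathbb{H}}S_k^{\Gamma}(z)\leq C\,k^{3/2}.$$ -/

import Mathlib

open scoped MatrixGroups UpperHalfPlane

namespace Fuchsian

/-- `PSL(2, ℝ)` acts on the upper half-plane by fractional linear transformations. -/
noncomputable instance pslAction : MulAction PSL(2, ℝ) ℍ :=
  MulAction.compHom ℍ Matrix.ProjectiveSpecialLinearGroup.toPGL

/-- The action of the class of `g ∈ SL(2, ℝ)` is the usual Möbius action of the matrix `g`. -/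
theorem psl_smul_mk (g : SL(2, ℝ)) (z : ℍ) :
    (QuotientGroup.mk g : PSL(2, ℝ)) • z = (g : GL (Fin 2) ℝ) • z :=
  UpperHalfPlane.pglMk_smul _ _

/-- The full group of matrices of determinant one (inside `GL(2, ℝ)`) that represent an element
of the subgroup `Γ` of `PSL(2, ℝ)`. -/
def matrices (Γ : Subgroup PSL(2, ℝ)) : Subgroup (GL (Fin 2) ℝ) :=
  (Γ.comap (QuotientGroup.mk' (Subgroup.center SL(2, ℝ)))).map Matrix.SpecialLinearGroup.toGL

instance (Γ : Subgroup PSL(2, ℝ)) : (matrices Γ).HasDetOne := by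
  unfold matrices
  infer_instance

/-- The extended upper half-plane `ℍ* = ℍ ∪ {cusps of 𝒢}` of a group of matrices `𝒢`; the cusps
are the points of `ℝ ∪ {∞}` that are fixed by a parabolic element of `𝒢`. -/
inductive ExtendedPlane (𝒢 : Subgroup (GL (Fin 2) ℝ)) : Type
  | point (z : ℍ) : ExtendedPlane 𝒢
  | cusp (c : cuspsSubMulAction 𝒢) : ExtendedPlane 𝒢

namespace ExtendedPlane

variable (𝒢 : Subgroup (GL (Fin 2) ℝ))

/-- The group acts on `ℍ` and on its own cusps, hence on `ℍ*`. -/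
noncomputable instance : MulAction 𝒢 (ExtendedPlane 𝒢) where
  smul g x := match x with
    | point z => point (g • z)
    | cusp c => cusp (g • c)
  one_smul x := match x with
    | point z => congrArg point (one_smul 𝒢 z)
    | cusp c => congrArg cusp (one_smul 𝒢 c)
  mul_smul g h x := match x with
    | point z => congrArg point (mul_smul g h z)
    | cusp c => congrArg cusp (mul_smul g h c)

/-- The horocycle topology on `ℍ*`: a set is open if its part in `ℍ` is open and if, for each
cusp `c` in it, it contains a horoball `g • {z | T < im z}` at `c = g • ∞`. (Whether this is
required for one `g ∈ SL(2, ℝ)` with `g • ∞ = c` or for all of them makes no difference.) -/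
instance : TopologicalSpace (ExtendedPlane 𝒢) where
  IsOpen U := IsOpen {z : ℍ | point z ∈ U} ∧
    ∀ c : cuspsSubMulAction 𝒢, cusp c ∈ U →
      ∀ g : SL(2, ℝ), (g : GL (Fin 2) ℝ) • (OnePoint.infty : OnePoint ℝ) = c →
        ∃ T : ℝ, ∀ z : ℍ, T < z.im → point (g • z) ∈ U
  isOpen_univ := ⟨isOpen_univ, fun _ _ _ _ ↦ ⟨0, fun _ _ ↦ trivial⟩⟩
  isOpen_inter U V hU hV := by
    refine ⟨hU.1.inter hV.1, fun c hc g hg ↦ ?_⟩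
    obtain ⟨S, hS⟩ := hU.2 c hc.1 g hg
    obtain ⟨T, hT⟩ := hV.2 c hc.2 g hg
    exact ⟨max S T, fun z hz ↦
      ⟨hS z ((le_max_left S T).trans_lt hz), hT z ((le_max_right S T).trans_lt hz)⟩⟩
  isOpen_sUnion A hA := by
    refine ⟨?_, ?_⟩
    · have : {z : ℍ | point z ∈ ⋃₀ A} = ⋃ U ∈ A, {z : ℍ | point z ∈ U} := by
        ext z
        simp
      rw [this]
      exact isOpen_biUnion fun U hU ↦ (hA U hU).1
    · rintro c ⟨U, hU, hc⟩ g hg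
      obtain ⟨T, hT⟩ := (hA U hU).2 c hc g hg
      exact ⟨T, fun z hz ↦ ⟨U, hU, hT z hz⟩⟩

end ExtendedPlane

/-- A *Fuchsian group of the first kind*: a discrete subgroup `Γ` of `PSL(2, ℝ)` for which the
quotient `Γ \ ℍ*` of the extended upper half-plane, that is, the quotient `Γ \ ℍ` together with
its cusps, is compact. -/
structure IsFirstKind (Γ : Subgroup PSL(2, ℝ)) : Prop where
  discrete : DiscreteTopology Γ
  compact_quotient :
    CompactSpace (Quotient (MulAction.orbitRel (matrices Γ) (ExtendedPlane (matrices Γ))))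

/-- The space of cusp forms of weight `2k` for `Γ`. -/
abbrev CuspForms (Γ : Subgroup PSL(2, ℝ)) (k : ℕ) : Type :=
  CuspForm (matrices Γ) (2 * (k : ℤ))

/-- The Petersson inner product `∫_F f conj(g) y^{2k} dx dy / y²`, computed over a fundamental
domain `F` (`volume` on `ℍ` is the hyperbolic measure `dx dy / y²`). -/
noncomputable def peterssonInner {Γ : Subgroup PSL(2, ℝ)} {k : ℕ} (F : Set ℍ)
    (f g : CuspForms Γ k) : ℂ :=
  ∫ z in F, f z * (starRingEnd ℂ) (g z) * (z.im : ℂ) ^ (2 * k)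

/-- The function `S_k^Γ(z) = ∑_j |f_j(z)|² Im(z)^{2k}` attached to cusp forms `f_1, …, f_d` of
weight `2k`. -/
noncomputable def sumSq {Γ : Subgroup PSL(2, ℝ)} {k d : ℕ} (f : Fin d → CuspForms Γ k)
    (z : ℍ) : ℝ :=
  ∑ j, ‖f j z‖ ^ 2 * z.im ^ (2 * k)

end Fuchsian

/-!
By the sub-mean value property, applied to `f` times a suitable exponential, `|f(z)|² Im(z)^{2k}` is
at most `9k` times the integral of `|f|² y^{2k}` over a Euclidean disc around `z` of radius
comparable to `Im(z) / √k`. Unfolding this integral over a fundamental domain bounds it by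
`#{γ ∈ Γ₀ : γ maps some point of the disc into the disc} · ‖f‖²`. Near a point of `ℍ` this number is
bounded. High in a cusp, Shimizu's lemma leaves only translations, and those in `Γ` number `O(√k)`
up to height `2kh`, where `h` is the width of the cusp for `Γ`; this gives `k^{3/2}`. Above that
height `|f| y^k` decreases, by the Schwarz lemma in the variable `exp(2πiz/h)`. All constants depend
only on `Γ₀`, and compactness of the quotient makes them uniform in `z`. Finally `S_k(z)` is the
largest value of `|f(z)|² Im(z)^{2k}` over the unit ball of the span of the `f_j`, so the bound for
single forms suffices.
-/

open MeasureTheory Set Metric UpperHalfPlane Filter Topology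
open scoped ENNReal NNReal Real Manifold MatrixGroups UpperHalfPlane Pointwise ModularForm
open scoped ComplexConjugate

namespace Fuchsian

section MeanValue

variable {E : Type*} [NormedAddCommGroup E] [NormedSpace ℂ E] [CompleteSpace E]

theorem two_pi_mul_enorm_le_lintegral_circleMap {f : ℂ → E} {c : ℂ} {r : ℝ}
    (hf : DiffContOnCl ℂ f (ball c |r|)) :
    ENNReal.ofReal (2 * π) * ‖f c‖ₑ ≤ ∫⁻ θ in Ioo (-π) π, ‖f (circleMap c r θ)‖ₑ := by
  have hmean : (2 * π) • f c = ∫ θ in (-π)..π, f (circleMap c r θ) := by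
    rw [← hf.circleAverage, Real.circleAverage_eq_integral_add (-π),
      smul_inv_smul₀ Real.two_pi_pos.ne',
      intervalIntegral.integral_comp_add_right (fun θ ↦ f (circleMap c r θ)), zero_add]
    ring_nf
  calc ENNReal.ofReal (2 * π) * ‖f c‖ₑ = ‖∫ θ in Ioo (-π) π, f (circleMap c r θ)‖ₑ := by
        rw [← integral_Ioc_eq_integral_Ioo,
          ← intervalIntegral.integral_of_le (by linarith [Real.pi_pos]), ← hmean, enorm_smul,
          Real.enorm_of_nonneg Real.two_pi_pos.le]
    _ ≤ _ := enorm_integral_le_lintegral_enorm _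

theorem lintegral_eq_lintegral_circleMap {f : ℂ → ℝ≥0∞} (hf : Measurable f) (c : ℂ) :
    ∫⁻ w, f w = ∫⁻ r in Ioi (0 : ℝ), ∫⁻ θ in Ioo (-π) π,
      ENNReal.ofReal r * f (circleMap c r θ) := by
  have hcirc : Measurable fun p : ℝ × ℝ ↦ circleMap c p.1 p.2 := by
    unfold circleMap
    fun_prop
  have hm : Measurable fun p : ℝ × ℝ ↦ ENNReal.ofReal p.1 * f (circleMap c p.1 p.2) :=
    (ENNReal.measurable_ofReal.comp measurable_fst).mul (hf.comp hcirc)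
  rw [← lintegral_add_left_eq_self (μ := volume) f c, ← Complex.lintegral_comp_polarCoord_symm,
    polarCoord_target, Measure.volume_eq_prod, ← Measure.prod_restrict,
    ← lintegral_prod _ hm.aemeasurable]
  simp only [Complex.polarCoord_symm_apply, smul_eq_mul, circleMap, Complex.exp_mul_I,
    Complex.ofReal_cos, Complex.ofReal_sin]

theorem setLIntegral_ofReal_Ioo {R : ℝ} (hR : 0 ≤ R) :
    ∫⁻ r in Ioo 0 R, ENNReal.ofReal r = ENNReal.ofReal (R ^ 2 / 2) := by
  rw [← ofReal_integral_eq_lintegral_ofReal (f := fun r : ℝ ↦ r)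
      ((continuous_id.integrableOn_Icc (μ := volume) (a := 0) (b := R)).mono_set
        Ioo_subset_Icc_self)
      ((ae_restrict_mem measurableSet_Ioo).mono fun x hx ↦ hx.1.le),
    ← integral_Ioc_eq_integral_Ioo, ← intervalIntegral.integral_of_le hR, integral_id]
  simp

theorem enorm_mul_volume_ball_le_lintegral {f : ℂ → E} {c : ℂ} {R : ℝ}
    (hf : DifferentiableOn ℂ f (ball c R)) :
    ‖f c‖ₑ * volume (ball c R) ≤ ∫⁻ w in ball c R, ‖f w‖ₑ := by
  rcases le_or_gt R 0 with hR | hR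
  · simp [ball_eq_empty.mpr hR]
  set F : ℂ → ℝ≥0∞ := (ball c R).indicator fun w ↦ ‖f w‖ₑ with hF
  have hFm : Measurable F := by
    classical
    rw [hF, ← piecewise_eq_indicator]
    exact (continuous_enorm.comp_continuousOn hf.continuousOn).measurable_piecewise
      continuousOn_const measurableSet_ball
  have hcircle : ∀ r ∈ Ioo 0 R, ENNReal.ofReal r * (ENNReal.ofReal (2 * π) * ‖f c‖ₑ) ≤
      ∫⁻ θ in Ioo (-π) π, ENNReal.ofReal r * F (circleMap c r θ) := by
    intro r hr
    have hsub : closedBall c |r| ⊆ ball c R :=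
      closedBall_subset_ball (by rw [abs_of_pos hr.1]; exact hr.2)
    have hval (θ : ℝ) : F (circleMap c r θ) = ‖f (circleMap c r θ)‖ₑ :=
      indicator_of_mem (hsub (sphere_subset_closedBall (circleMap_mem_sphere' c r θ))) _
    rw [lintegral_const_mul' _ _ ENNReal.ofReal_ne_top]
    simp only [hval]
    gcongr
    exact two_pi_mul_enorm_le_lintegral_circleMap
      (hf.mono (closure_ball_subset_closedBall.trans hsub)).diffContOnCl
  calc ‖f c‖ₑ * volume (ball c R)
      = ∫⁻ r in Ioo 0 R, ENNReal.ofReal r * (ENNReal.ofReal (2 * π) * ‖f c‖ₑ) := by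
        rw [lintegral_mul_const _ ENNReal.measurable_ofReal, setLIntegral_ofReal_Ioo hR.le,
          ← mul_assoc, ← ENNReal.ofReal_mul (by positivity), mul_comm, Complex.volume_ball,
          ← ENNReal.ofReal_pow hR.le, ← ENNReal.ofReal_coe_nnreal, NNReal.coe_real_pi,
          ← ENNReal.ofReal_mul (by positivity)]
        ring_nf
    _ ≤ ∫⁻ r in Ioo 0 R, ∫⁻ θ in Ioo (-π) π, ENNReal.ofReal r * F (circleMap c r θ) :=
        setLIntegral_mono' measurableSet_Ioo hcircle
    _ ≤ ∫⁻ r in Ioi (0 : ℝ), ∫⁻ θ in Ioo (-π) π, ENNReal.ofReal r * F (circleMap c r θ) :=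
        lintegral_mono_set Ioo_subset_Ioi_self
    _ = ∫⁻ w in ball c R, ‖f w‖ₑ := by
        rw [← lintegral_eq_lintegral_circleMap hFm, lintegral_indicator measurableSet_ball]

end MeanValue

section Weighted

/-- The function `f(z) im(z)^k`. If `f` has weight `2k` for a group, then the modulus of this
function is invariant under that group. -/
noncomputable def weighted (k : ℕ) (f : ℍ → ℂ) (z : ℍ) : ℂ :=
  f z * (z.im : ℂ) ^ k

theorem norm_weighted (k : ℕ) (f : ℍ → ℂ) (z : ℍ) : ‖weighted k f z‖ = ‖f z‖ * z.im ^ k := by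
  rw [weighted, norm_mul, norm_pow, Complex.norm_of_nonneg z.im_pos.le]

theorem continuous_weighted (k : ℕ) {f : ℍ → ℂ} (hf : Continuous f) :
    Continuous (weighted k f) := by
  have := continuous_im
  unfold weighted
  fun_prop

/-- The Euclidean disc around `z` of radius `im z / (2√k)`: on it the weight `im(w)^k` agrees, up
to a constant independent of `k`, with the modulus of an exponential function. -/
def weightDisc (k : ℕ) (z : ℍ) : Set ℍ :=
  {w | (w : ℂ) ∈ ball (z : ℂ) (z.im / (2 * √k))}

theorem measurableSet_weightDisc (k : ℕ) (z : ℍ) : MeasurableSet (weightDisc k z) :=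
  measurable_coe measurableSet_ball

theorem exp_le_one_add_mul_exp_sq {t : ℝ} (ht : -(1 / 2) ≤ t) :
    Real.exp t ≤ (1 + t) * Real.exp (2 * t ^ 2) := by
  have hpos : 0 < 1 + t := by linarith
  have hlog : t - 2 * t ^ 2 ≤ Real.log (1 + t) := by
    refine le_trans ?_ (Real.one_sub_inv_le_log_of_pos hpos)
    rw [← sub_nonneg]
    have hid : 1 - (1 + t)⁻¹ - (t - 2 * t ^ 2) = t ^ 2 * (1 + 2 * t) / (1 + t) := by
      field_simp
      ring
    have : 0 ≤ 1 + 2 * t := by linarith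
    rw [hid]
    positivity
  rw [← Real.exp_log hpos, ← Real.exp_add, Real.exp_le_exp]
  linarith

theorem abs_im_div_im_sub_one_le {k : ℕ} {z w : ℂ} (hz : 0 < z.im)
    (hw : w ∈ ball z (z.im / (2 * √k))) : |w.im / z.im - 1| ≤ 1 / (2 * √k) := by
  have him : |w.im - z.im| ≤ z.im / (2 * √k) := by
    rw [← Complex.sub_im]
    exact (Complex.abs_im_le_norm _).trans (mem_ball_iff_norm.mp hw).le
  rw [div_sub_one hz.ne', abs_div, abs_of_pos hz, div_le_iff₀ hz]
  exact him.trans_eq (by ring)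

theorem abs_im_div_im_sub_one_le_half {k : ℕ} (hk : 0 < k) {z w : ℂ} (hz : 0 < z.im)
    (hw : w ∈ ball z (z.im / (2 * √k))) : |w.im / z.im - 1| ≤ 1 / 2 := by
  have hsqrt : 1 ≤ √(k : ℝ) := Real.one_le_sqrt.mpr (by exact_mod_cast hk)
  refine (abs_im_div_im_sub_one_le hz hw).trans ?_
  gcongr
  linarith

theorem im_pos_of_mem_ball {k : ℕ} (hk : 0 < k) {z w : ℂ} (hz : 0 < z.im)
    (hw : w ∈ ball z (z.im / (2 * √k))) : 0 < w.im := by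
  have := (abs_le.mp (abs_im_div_im_sub_one_le_half hk hz hw)).1
  exact (div_pos_iff_of_pos_right hz).mp (by linarith)

theorem im_pow_mul_exp_le {k : ℕ} (hk : 0 < k) {z w : ℂ} (hz : 0 < z.im)
    (hw : w ∈ ball z (z.im / (2 * √k))) :
    z.im ^ (2 * k) * Real.exp (2 * k * (w.im / z.im - 1)) ≤ Real.exp 1 * w.im ^ (2 * k) := by
  set t := w.im / z.im - 1 with ht
  have hk0 : (0 : ℝ) < k := by exact_mod_cast hk
  have hkt : 4 * k * t ^ 2 ≤ 1 := by
    calc 4 * k * t ^ 2 ≤ 4 * k * (1 / (2 * √k)) ^ 2 := by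
          rw [← sq_abs]
          gcongr
          exact abs_im_div_im_sub_one_le hz hw
      _ = 1 := by
          rw [div_pow, mul_pow, Real.sq_sqrt hk0.le]
          field_simp
          norm_num
  have hexp : Real.exp t ≤ w.im / z.im * Real.exp (2 * t ^ 2) := by
    refine (exp_le_one_add_mul_exp_sq ?_).trans_eq (by rw [ht]; ring_nf)
    exact (abs_le.mp (abs_im_div_im_sub_one_le_half hk hz hw)).1
  calc z.im ^ (2 * k) * Real.exp (2 * k * t) = (z.im * Real.exp t) ^ (2 * k) := by
        rw [mul_pow, ← Real.exp_nat_mul]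
        push_cast
        rfl
    _ ≤ (z.im * (w.im / z.im * Real.exp (2 * t ^ 2))) ^ (2 * k) := by gcongr
    _ = Real.exp (4 * k * t ^ 2) * w.im ^ (2 * k) := by
        rw [← mul_assoc, mul_div_cancel₀ _ hz.ne', mul_pow, ← Real.exp_nat_mul, mul_comm]
        push_cast
        ring_nf
    _ ≤ Real.exp 1 * w.im ^ (2 * k) := by
        gcongr
        exact Even.pow_nonneg (even_two_mul k) _

theorem norm_cexp_neg_I_mul_sub_div (k : ℕ) (z w : ℂ) :
    ‖Complex.exp (-Complex.I * k * (w - z) / z.im)‖ = Real.exp (k * ((w.im - z.im) / z.im)) := by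
  rw [Complex.norm_exp, Complex.div_ofReal_re]
  simp [mul_div_assoc]

theorem enorm_sq_mul_volume_ball_le {k : ℕ} (hk : 0 < k) {z : ℂ} (hz : 0 < z.im) {f : ℂ → ℂ}
    (hf : DifferentiableOn ℂ f (ball z (z.im / (2 * √k)))) :
    ‖f z * z.im ^ k‖ₑ ^ 2 * volume (ball z (z.im / (2 * √k))) ≤
      ENNReal.ofReal (Real.exp 1) *
        ∫⁻ w in ball z (z.im / (2 * √k)), ‖f w * w.im ^ k‖ₑ ^ 2 := by
  -- The holomorphic factor `exp(-ik(w - z)/y)` has modulus `exp(k(im w / y - 1))`, which replaces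
  -- the weight `(im w / y)^k` up to a constant.
  set G : ℂ → ℂ := fun w ↦
    (f w * Complex.exp (-Complex.I * k * (w - z) / z.im) * z.im ^ k) ^ 2 with hG
  have hGd : DifferentiableOn ℂ G (ball z (z.im / (2 * √k))) :=
    ((hf.mul (by fun_prop)).mul_const _).pow 2
  have hGz : ‖G z‖ₑ = ‖f z * z.im ^ k‖ₑ ^ 2 := by simp [hG, enorm_pow]
  have hle : ∀ w ∈ ball z (z.im / (2 * √k)),
      ‖G w‖ₑ ≤ ENNReal.ofReal (Real.exp 1) * ‖f w * w.im ^ k‖ₑ ^ 2 := by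
    intro w hw
    rw [← ofReal_norm, ← ofReal_norm, ← ENNReal.ofReal_pow (norm_nonneg _),
      ← ENNReal.ofReal_mul (Real.exp_pos 1).le]
    refine ENNReal.ofReal_le_ofReal ?_
    calc ‖G w‖ = ‖f w‖ ^ 2 *
          (z.im ^ (2 * k) * Real.exp (2 * k * (w.im / z.im - 1))) := by
          rw [hG, norm_pow, norm_mul, norm_mul, norm_cexp_neg_I_mul_sub_div, norm_pow,
            Complex.norm_of_nonneg hz.le, mul_pow, mul_pow, ← Real.exp_nat_mul, sub_div,
            div_self hz.ne', ← pow_mul, mul_comm k 2]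
          push_cast
          ring_nf
      _ ≤ ‖f w‖ ^ 2 * (Real.exp 1 * w.im ^ (2 * k)) := by
          gcongr ?_ * ?_
          exact im_pow_mul_exp_le hk hz hw
      _ = Real.exp 1 * ‖f w * w.im ^ k‖ ^ 2 := by
          rw [norm_mul, norm_pow, Complex.norm_of_nonneg (im_pos_of_mem_ball hk hz hw).le]
          ring
  calc _ = ‖G z‖ₑ * volume (ball z (z.im / (2 * √k))) := by rw [hGz]
    _ ≤ ∫⁻ w in ball z (z.im / (2 * √k)), ‖G w‖ₑ := enorm_mul_volume_ball_le_lintegral hGd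
    _ ≤ _ := (setLIntegral_mono' measurableSet_ball hle).trans_eq
        (lintegral_const_mul' _ _ ENNReal.ofReal_ne_top)

end Weighted

section HyperbolicMeanValue

theorem setLIntegral_upperHalfPlane_eq {φ : ℍ → ℝ≥0∞} (hφ : Measurable φ) {s : Set ℍ}
    (hs : MeasurableSet s) :
    ∫⁻ z in s, φ z = ∫⁻ w in UpperHalfPlane.coe '' s,
      ENNReal.ofReal (1 / w.im ^ 2) * φ (ofComplex w) := by
  have hpres : MeasurePreserving UpperHalfPlane.coe
      ((volume : Measure ℂ).comap UpperHalfPlane.coe)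
      (volume.restrict (range UpperHalfPlane.coe)) :=
    ⟨measurable_coe, by rw [measurableEmbedding_coe.map_comap]⟩
  have hdens (z : ℍ) : (((1 / NNReal.mk z.im z.im_pos.le : ℝ≥0) ^ 2 : ℝ≥0) : ℝ≥0∞) =
      ENNReal.ofReal (1 / z.im ^ 2) := by
    rw [ENNReal.ofReal, ENNReal.coe_inj, ← NNReal.coe_inj, Real.coe_toNNReal _ (by positivity)]
    simp
  have hm : Measurable fun z : ℍ ↦ ENNReal.ofReal (1 / z.im ^ 2) := by
    have : Measurable UpperHalfPlane.im := continuous_im.measurable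
    fun_prop
  rw [volume_def]
  simp only [hdens]
  rw [setLIntegral_withDensity_eq_setLIntegral_mul _ hm hφ hs,
    ← inter_eq_self_of_subset_left (image_subset_range UpperHalfPlane.coe s),
    ← Measure.restrict_restrict' measurableEmbedding_coe.measurableSet_range,
    ← hpres.setLIntegral_comp_emb measurableEmbedding_coe]
  simp only [Pi.mul_apply, coe_im, ofComplex_apply]

theorem image_coe_weightDisc {k : ℕ} (hk : 0 < k) (z : ℍ) :
    UpperHalfPlane.coe '' weightDisc k z = ball (z : ℂ) (z.im / (2 * √k)) := by
  refine Subset.antisymm (image_subset_iff.mpr fun w hw ↦ hw) fun w hw ↦ ?_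
  exact ⟨⟨w, im_pos_of_mem_ball hk z.im_pos hw⟩, hw, rfl⟩

theorem volume_ball_im_div_two_mul_sqrt {k : ℕ} (z : ℍ) :
    volume (ball (z : ℂ) (z.im / (2 * √k))) = ENNReal.ofReal (π * z.im ^ 2 / (4 * k)) := by
  have := z.im_pos
  rw [Complex.volume_ball, ← ENNReal.ofReal_pow (by positivity), ← ENNReal.ofReal_coe_nnreal,
    NNReal.coe_real_pi, ← ENNReal.ofReal_mul (by positivity), div_pow, mul_pow,
    Real.sq_sqrt k.cast_nonneg]
  ring_nf

theorem enorm_sq_le_hyperbolic_density {k : ℕ} (hk : 0 < k) (f : ℍ → ℂ) (z : ℍ) {w : ℂ}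
    (hw : w ∈ ball (z : ℂ) (z.im / (2 * √k))) :
    ‖f (ofComplex w) * w.im ^ k‖ₑ ^ 2 ≤ ENNReal.ofReal (9 / 4 * z.im ^ 2) *
      (ENNReal.ofReal (1 / w.im ^ 2) * ‖weighted k f (ofComplex w)‖ₑ ^ 2) := by
  have hw0 : 0 < w.im := im_pos_of_mem_ball hk z.im_pos hw
  have him : w.im ≤ 3 / 2 * z.im := by
    have := (abs_le.mp (abs_im_div_im_sub_one_le_half hk z.im_pos hw)).2
    rw [← div_le_iff₀ z.im_pos, ← coe_im]
    linarith
  have hone : 1 ≤ ENNReal.ofReal (9 / 4 * z.im ^ 2) * ENNReal.ofReal (1 / w.im ^ 2) := by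
    rw [← ENNReal.ofReal_mul (by positivity), ENNReal.one_le_ofReal, mul_one_div,
      one_le_div (by positivity)]
    nlinarith
  rw [← mul_assoc, weighted, ofComplex_apply_of_im_pos hw0]
  exact le_mul_of_one_le_left zero_le hone

theorem enorm_weighted_sq_le_lintegral {k : ℕ} (hk : 0 < k) {f : ℍ → ℂ} (hf : MDiff f) (z : ℍ) :
    ‖weighted k f z‖ₑ ^ 2 ≤
      ENNReal.ofReal (9 * k) * ∫⁻ w in weightDisc k z, ‖weighted k f w‖ₑ ^ 2 := by
  have hy := z.im_pos
  have : (0 : ℝ) < k := by exact_mod_cast hk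
  have hd : DifferentiableOn ℂ (f ∘ ofComplex) (ball z (z.im / (2 * √k))) :=
    (UpperHalfPlane.mdifferentiable_iff.mp hf).mono fun w hw ↦ im_pos_of_mem_ball hk hy hw
  have hm : Measurable fun w ↦ ‖weighted k f w‖ₑ ^ 2 :=
    (continuous_weighted k hf.continuous).measurable.enorm.pow_const 2
  have hmean : ‖weighted k f z‖ₑ ^ 2 * ENNReal.ofReal (π * z.im ^ 2 / (4 * k)) ≤
      ENNReal.ofReal (Real.exp 1) * (ENNReal.ofReal (9 / 4 * z.im ^ 2) *
        ∫⁻ w in weightDisc k z, ‖weighted k f w‖ₑ ^ 2) := by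
    rw [setLIntegral_upperHalfPlane_eq hm (measurableSet_weightDisc k z),
      image_coe_weightDisc hk, ← volume_ball_im_div_two_mul_sqrt,
      ← lintegral_const_mul' _ _ ENNReal.ofReal_ne_top]
    have hball := enorm_sq_mul_volume_ball_le hk hy hd
    rw [Function.comp_apply, ofComplex_apply] at hball
    refine hball.trans (mul_le_mul_right (setLIntegral_mono' measurableSet_ball fun w hw ↦ ?_) _)
    exact enorm_sq_le_hyperbolic_density hk f z hw
  calc ‖weighted k f z‖ₑ ^ 2
      = ENNReal.ofReal (4 * k / (π * z.im ^ 2)) *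
          (‖weighted k f z‖ₑ ^ 2 * ENNReal.ofReal (π * z.im ^ 2 / (4 * k))) := by
        rw [mul_left_comm, ← ENNReal.ofReal_mul (by positivity),
          div_mul_div_cancel₀' (by positivity), div_self (by positivity), ENNReal.ofReal_one,
          mul_one]
    _ ≤ _ := mul_le_mul_right hmean _
    _ = ENNReal.ofReal (9 * k * (Real.exp 1 / π)) *
          ∫⁻ w in weightDisc k z, ‖weighted k f w‖ₑ ^ 2 := by
        rw [← mul_assoc, ← mul_assoc, ← ENNReal.ofReal_mul (by positivity),
          ← ENNReal.ofReal_mul (by positivity)]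
        congr 2
        field_simp
    _ ≤ _ := by
        gcongr ENNReal.ofReal ?_ * _
        refine mul_le_of_le_one_right (by positivity) ((div_le_one Real.pi_pos).mpr ?_)
        linarith [Real.exp_one_lt_d9, Real.pi_gt_three]

end HyperbolicMeanValue

section CuspDecay

variable {h Y : ℝ} {f : ℍ → ℂ}

theorem norm_cuspFunction_le_of_horocycle (hh : 0 < h)
    (hper : Function.Periodic (f ∘ ofComplex) h) (hf : MDiff f) (hbdd : IsBoundedAtImInfty f)
    (hY : 0 < Y) {M : ℝ} (hM : ∀ z : ℍ, z.im = Y → ‖f z‖ ≤ M) {q : ℂ}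
    (hq : q ∈ ball 0 (Real.exp (-2 * π * Y / h))) :
    ‖UpperHalfPlane.cuspFunction h f q‖ ≤ M := by
  have hr1 : Real.exp (-2 * π * Y / h) < 1 := by
    rw [Real.exp_lt_one_iff, neg_mul, neg_mul, neg_div, neg_lt_zero]
    positivity
  have hd : DifferentiableOn ℂ (UpperHalfPlane.cuspFunction h f)
      (closure (ball 0 (Real.exp (-2 * π * Y / h)))) :=
    (differentiableOn_cuspFunction_ball hh hper hf hbdd).mono
      (closure_ball_subset_closedBall.trans (closedBall_subset_ball hr1))
  refine Complex.norm_le_of_forall_mem_frontier_norm_le isBounded_ball hd.diffContOnCl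
    (fun p hp ↦ ?_) (subset_closure hq)
  rw [frontier_ball _ (Real.exp_pos _).ne', mem_sphere_zero_iff_norm] at hp
  have hp0 : p ≠ 0 := norm_pos_iff.mp (hp ▸ Real.exp_pos _)
  have him : (Function.Periodic.invQParam h p).im = Y := by
    rw [Function.Periodic.im_invQParam, hp, Real.log_exp]
    field_simp
  have heq := UpperHalfPlane.eq_cuspFunction
    (⟨Function.Periodic.invQParam h p, him ▸ hY⟩ : ℍ) hh.ne' hper
  rw [UpperHalfPlane.coe_mk, Function.Periodic.qParam_right_inv hh.ne' hp0] at heq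
  rw [heq]
  exact hM _ him

theorem norm_le_mul_exp_of_horocycle (hh : 0 < h)
    (hper : Function.Periodic (f ∘ ofComplex) h) (hf : MDiff f) (hzero : IsZeroAtImInfty f)
    (hY : 0 < Y) {M : ℝ} (hM : ∀ z : ℍ, z.im = Y → ‖f z‖ ≤ M) {z : ℍ} (hz : Y ≤ z.im) :
    ‖f z‖ ≤ M * Real.exp (-(2 * π * (z.im - Y) / h)) := by
  rcases hz.eq_or_lt with hz | hz
  · simpa [hz] using hM z hz.symm
  have hbdd : IsBoundedAtImInfty f := hzero.isBoundedAtImInfty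
  set r := Real.exp (-2 * π * Y / h) with hr
  have hcusp : UpperHalfPlane.cuspFunction h f 0 = 0 := by
    rw [UpperHalfPlane.cuspFunction_apply_zero hh
      (UpperHalfPlane.analyticAt_cuspFunction_zero hh hper hf hbdd) hper,
      hzero.valueAtInfty_eq_zero]
  have hr1 : r ≤ 1 := by
    rw [hr, Real.exp_le_one_iff, neg_mul, neg_mul, neg_div, neg_nonpos]
    positivity
  have hq : ‖Function.Periodic.qParam h z‖ < r := by
    rw [Function.Periodic.norm_qParam, hr, Real.exp_lt_exp, coe_im]
    gcongr ?_ / h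
    nlinarith [Real.pi_pos]
  have hschwarz := Complex.dist_le_div_mul_dist_of_mapsTo_ball (R₂ := M)
    ((differentiableOn_cuspFunction_ball hh hper hf hbdd).mono (ball_subset_ball hr1))
    (fun q hq ↦ by
      simpa [hcusp] using norm_cuspFunction_le_of_horocycle hh hper hf hbdd hY hM hq)
    (mem_ball_zero_iff.mpr hq)
  rw [hcusp, dist_zero_right, dist_zero_right, UpperHalfPlane.eq_cuspFunction z hh.ne' hper,
    Function.Periodic.norm_qParam, hr, div_mul_eq_mul_div, mul_div_assoc, ← Real.exp_sub,
    coe_im] at hschwarz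
  refine hschwarz.trans_eq ?_
  ring_nf

theorem norm_weighted_le_of_horocycle (hh : 0 < h)
    (hper : Function.Periodic (f ∘ ofComplex) h) (hf : MDiff f) (hzero : IsZeroAtImInfty f)
    {k : ℕ} (hY : 0 < Y) (hkY : k * h ≤ 2 * π * Y) {A : ℝ}
    (hA : ∀ z : ℍ, z.im = Y → ‖weighted k f z‖ ≤ A) {z : ℍ} (hz : Y ≤ z.im) :
    ‖weighted k f z‖ ≤ A := by
  have hA0 : 0 ≤ A := (norm_nonneg _).trans (hA ⟨⟨0, Y⟩, hY⟩ rfl)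
  have hM : ∀ w : ℍ, w.im = Y → ‖f w‖ ≤ A / Y ^ k := by
    intro w hw
    rw [le_div_iff₀ (by positivity), ← hw, ← norm_weighted]
    exact hA w hw
  set t := (z.im - Y) / Y with ht
  have : 0 ≤ t := div_nonneg (sub_nonneg.mpr hz) hY.le
  have hzt : z.im = Y * (1 + t) := by
    rw [ht]
    field_simp
    ring
  have hkt : k * t ≤ 2 * π * (z.im - Y) / h := by
    rw [le_div_iff₀ hh]
    calc k * t * h = k * h * t := by ring
      _ ≤ 2 * π * Y * t := by gcongr
      _ = 2 * π * (z.im - Y) := by rw [hzt]; ring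
  calc ‖weighted k f z‖ = ‖f z‖ * (Y * (1 + t)) ^ k := by rw [norm_weighted, hzt]
    _ ≤ A / Y ^ k * Real.exp (-(k * t)) * (Y * Real.exp t) ^ k := by
        gcongr
        · refine (norm_le_mul_exp_of_horocycle hh hper hf hzero hY hM hz).trans ?_
          gcongr
        · rw [add_comm]
          exact Real.add_one_le_exp t
    _ = A := by
        rw [mul_pow, ← Real.exp_nat_mul, Real.exp_neg]
        field_simp

end CuspDecay

section Unfolding

variable {G α : Type*} [Group G] [MulAction G α] [MeasurableSpace α] {μ : Measure α}
  [MeasurableConstSMul G α] [SMulInvariantMeasure G α μ] {Γ : Subgroup G} [Countable Γ]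

theorem setLIntegral_le_card_mul {F : Set α} (hF : IsFundamentalDomain Γ F μ) {φ : α → ℝ≥0∞}
    (hφ : Measurable φ) (hinv : ∀ γ ∈ Γ, ∀ x, φ (γ • x) = φ x) {B : Set α}
    (hB : MeasurableSet B) {t : Finset G}
    (ht : ∀ γ ∈ Γ, ∀ x ∈ B, γ • x ∈ B → γ ∈ t) :
    ∫⁻ x in B, φ x ∂μ ≤ t.card * ∫⁻ x in F, φ x ∂μ := by
  have hcard (x : α) : {γ : Γ | γ • x ∈ B}.encard ≤ t.card := by
    rcases eq_empty_or_nonempty {γ : Γ | γ • x ∈ B} with hempty | ⟨γ₀, hγ₀⟩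
    · simp [hempty]
    · rw [← encard_coe_eq_coe_finsetCard]
      refine encard_le_encard_of_injOn (f := fun γ ↦ ((γ * γ₀⁻¹ : Γ) : G)) (fun γ hγ ↦ ?_)
        (fun a _ b _ hab ↦ mul_right_cancel (Subtype.ext hab))
      refine ht _ (γ * γ₀⁻¹).2 (γ₀ • x) hγ₀ ?_
      rw [← Subgroup.smul_def, smul_smul, inv_mul_cancel_right]
      exact hγ
  have hindicator (x : α) (γ : Γ) :
      B.indicator φ (γ • x) = {γ : Γ | γ • x ∈ B}.indicator (fun _ ↦ φ x) γ := by
    have hγx : φ (γ • x) = φ x := hinv γ γ.2 x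
    by_cases hγ : γ • x ∈ B <;> simp [hγ, hγx]
  calc ∫⁻ x in B, φ x ∂μ = ∫⁻ x in F, ∑' γ : Γ, B.indicator φ (γ • x) ∂μ := by
        rw [← lintegral_indicator hB, hF.lintegral_eq_tsum'', ← lintegral_tsum fun γ : Γ ↦ ?_]
        exact ((hφ.indicator hB).comp (measurable_const_smul γ)).aemeasurable
    _ ≤ ∫⁻ x in F, t.card * φ x ∂μ := by
        refine lintegral_mono fun x ↦ ?_
        simp_rw [hindicator x]
        rw [← tsum_subtype, ENNReal.tsum_set_const]
        gcongr
        exact_mod_cast ENat.toENNReal_le.mpr (hcard x)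
    _ = t.card * ∫⁻ x in F, φ x ∂μ := lintegral_const_mul _ hφ

end Unfolding

section Discrete

theorem discreteTopology_comap {G H : Type*} [Group G] [TopologicalSpace G]
    [IsTopologicalGroup G] [T1Space G] [Group H] [TopologicalSpace H] {f : G →* H}
    (hf : Continuous f) [Finite f.ker] (Γ : Subgroup H) [DiscreteTopology Γ] :
    DiscreteTopology (Γ.comap f) := by
  set p : Γ.comap f → Γ := fun s ↦ ⟨f s, s.2⟩
  have hopen : IsOpen (p ⁻¹' {1}) :=
    (isOpen_discrete _).preimage ((hf.comp continuous_subtype_val).subtype_mk _)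
  have hfin : (p ⁻¹' {1}).Finite :=
    Set.Finite.of_injOn (f := Subtype.val) (t := (f.ker : Set G))
      (fun s hs ↦ congrArg Subtype.val hs) Subtype.val_injective.injOn (Set.toFinite _)
  have hone : ({1} : Set (Γ.comap f)) = p ⁻¹' {1} \ (p ⁻¹' {1} \ {1}) := by
    rw [sdiff_sdiff_right_self, eq_comm, inter_eq_right, singleton_subset_iff]
    exact Subtype.ext (map_one f)
  refine discreteTopology_of_isOpen_singleton_one ?_
  rw [hone]
  exact hopen.sdiff (hfin.subset sdiff_subset).isClosed

/-- The projection of `SL(2, ℝ)` onto `PSL(2, ℝ)`. -/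
abbrev toPSL : SL(2, ℝ) →* PSL(2, ℝ) := QuotientGroup.mk' _

instance : Finite toPSL.ker := by
  have : NeZero (max (Fintype.card (Fin 2)) 1) := ⟨by simp⟩
  rw [QuotientGroup.ker_mk']
  exact Finite.of_equiv _
    (Matrix.SpecialLinearGroup.center_equiv_rootsOfUnity (n := Fin 2) (R := ℝ)).symm.toEquiv

/-- The subgroup of all elements of `SL(2, ℝ)` that represent an element of `Γ`. -/
abbrev preimage (Γ : Subgroup PSL(2, ℝ)) : Subgroup SL(2, ℝ) := Γ.comap toPSL

instance (Γ : Subgroup PSL(2, ℝ)) [DiscreteTopology Γ] : DiscreteTopology (preimage Γ) :=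
  discreteTopology_comap QuotientGroup.continuous_mk Γ

theorem toGL_mem_matrices {Γ : Subgroup PSL(2, ℝ)} {s : SL(2, ℝ)} :
    (s : GL (Fin 2) ℝ) ∈ matrices Γ ↔ s ∈ preimage Γ :=
  Subgroup.mem_map_iff_mem Matrix.SpecialLinearGroup.toGL_injective

instance (Γ : Subgroup PSL(2, ℝ)) [DiscreteTopology Γ] : DiscreteTopology (matrices Γ) :=
  have : DiscreteTopology (preimage Γ : Set SL(2, ℝ)) :=
    inferInstanceAs (DiscreteTopology (preimage Γ))
  (Matrix.SpecialLinearGroup.isEmbedding_toGL.homeomorphImage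
    (preimage Γ : Set SL(2, ℝ))).symm.isEmbedding.discreteTopology

instance : SecondCountableTopology SL(2, ℝ) :=
  have : SecondCountableTopology (Matrix (Fin 2) (Fin 2) ℝ) :=
    inferInstanceAs (SecondCountableTopology (Fin 2 → Fin 2 → ℝ))
  Topology.IsEmbedding.subtypeVal.secondCountableTopology

instance (Γ : Subgroup PSL(2, ℝ)) [DiscreteTopology Γ] : Countable Γ :=
  countable_of_Lindelof_of_discrete

theorem isCompact_setOf_abs_entry_le (M : ℝ) : IsCompact {s : SL(2, ℝ) | ∀ i j, |s i j| ≤ M} := by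
  have hpi : {m : Fin 2 → Fin 2 → ℝ | ∀ i j, |m i j| ≤ M} =
      univ.pi fun _ ↦ univ.pi fun _ ↦ Icc (-M) M := by
    ext m
    simp only [mem_ofPred_eq, abs_le, mem_univ_pi, mem_Icc]
  have hbox : IsCompact {m : Matrix (Fin 2) (Fin 2) ℝ | ∀ i j, |m i j| ≤ M} :=
    hpi ▸ isCompact_univ_pi fun _ ↦ isCompact_univ_pi fun _ ↦ isCompact_Icc
  exact Matrix.SpecialLinearGroup.isClosedEmbedding_val.isCompact_preimage hbox

theorem finite_mem_of_isCompact {G : Type*} [Group G] [TopologicalSpace G] [IsTopologicalGroup G]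
    [T2Space G] {L : Subgroup G} [hL : DiscreteTopology L] {K : Set G} (hK : IsCompact K) :
    {s | s ∈ L ∧ s ∈ K}.Finite :=
  (hK.inter_left L.isClosed_of_discrete).finite (IsDiscrete.mono ⟨hL⟩ inter_subset_left)

end Discrete

section Shimizu

/-- The matrix of the translation by `b`. -/
def shift (b : ℝ) : SL(2, ℝ) := ⟨!![1, b; 0, 1], by simp⟩

theorem coe_shift (b : ℝ) : (shift b : Matrix (Fin 2) (Fin 2) ℝ) = !![1, b; 0, 1] := rfl

theorem toGL_shift (b : ℝ) :
    (shift b : GL (Fin 2) ℝ) = Matrix.GeneralLinearGroup.upperRightHom b := by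
  ext i j
  change !![1, b; 0, 1] i j = _
  simp

theorem coe_mul_shift_mul_inv (s : SL(2, ℝ)) (b : ℝ) :
    ((s * shift b * s⁻¹ : SL(2, ℝ)) : Matrix (Fin 2) (Fin 2) ℝ) =
      !![1 - s 0 0 * s 1 0 * b, s 0 0 ^ 2 * b; -(s 1 0 ^ 2 * b), 1 + s 0 0 * s 1 0 * b] := by
  have hdet := s.det_coe
  rw [Matrix.det_fin_two] at hdet
  rw [Matrix.SpecialLinearGroup.coe_mul, Matrix.SpecialLinearGroup.coe_mul,
    Matrix.SpecialLinearGroup.coe_inv, coe_shift, Matrix.adjugate_fin_two,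
    Matrix.eta_fin_two (s : Matrix (Fin 2) (Fin 2) ℝ), Matrix.mul_fin_two, Matrix.mul_fin_two]
  ext i j
  fin_cases i <;> fin_cases j <;> simp
  · linear_combination hdet
  · ring
  · ring
  · linear_combination hdet

theorem abs_entries_mul_shift_mul_inv_le {s : SL(2, ℝ)} {h M : ℝ} (hh : 0 ≤ h)
    (ha : |s 0 0| ≤ M) (hM : 1 + |s 1 0| * h * M ≤ M) :
    |(s * shift h * s⁻¹) 0 0| ≤ M ∧ |(s * shift h * s⁻¹) 0 1| ≤ M ^ 2 * h ∧
      |(s * shift h * s⁻¹) 1 1| ≤ M := by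
  have hprod : |s 0 0 * s 1 0 * h| ≤ M - 1 := by
    rw [abs_mul, abs_mul, abs_of_nonneg hh]
    calc |s 0 0| * |s 1 0| * h ≤ M * |s 1 0| * h := by gcongr
      _ ≤ M - 1 := by linarith
  rw [coe_mul_shift_mul_inv]
  refine ⟨?_, ?_, ?_⟩
  · exact (abs_sub _ _).trans (by rw [abs_one]; linarith)
  · change |s 0 0 ^ 2 * h| ≤ _
    rw [abs_mul, abs_pow, abs_of_nonneg hh]
    gcongr
  · exact (abs_add_le _ _).trans (by rw [abs_one]; linarith)

theorem one_le_abs_lower_left_mul {L : Subgroup SL(2, ℝ)} [DiscreteTopology L] {h : ℝ}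
    (hh : 0 < h) (hmem : shift h ∈ L) {s : SL(2, ℝ)} (hs : s ∈ L) (hc : s 1 0 ≠ 0) :
    1 ≤ |s 1 0| * h := by
  by_contra! hlt
  -- Conjugating the translation by `s` keeps the entries bounded and shrinks `|c|` to `|c|²h`.
  set M := max |s 0 0| (1 / (1 - |s 1 0| * h)) with hM_def
  have : 0 ≤ M := (abs_nonneg _).trans (le_max_left _ _)
  have hM : 1 + |s 1 0| * h * M ≤ M := by
    have := le_max_right |s 0 0| (1 / (1 - |s 1 0| * h))
    rw [← hM_def, div_le_iff₀ (by linarith)] at this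
    linarith
  set B : Set SL(2, ℝ) := {u | u ∈ L ∧ u 1 0 ≠ 0 ∧ |u 1 0| ≤ |s 1 0| ∧ |u 0 0| ≤ M}
  set N := max (max M (M ^ 2 * h)) |s 1 0|
  set A : Set SL(2, ℝ) := B ∩ {u | ∀ i j, |u i j| ≤ N}
  have hstep : ∀ u ∈ B, u * shift h * u⁻¹ ∈ A ∧ |(u * shift h * u⁻¹) 1 0| < |u 1 0| := by
    rintro u ⟨huL, huc, hus, hua⟩
    obtain ⟨h00, h01, h11⟩ := abs_entries_mul_shift_mul_inv_le hh.le hua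
      (hM.trans' (by gcongr))
    have h10 : (u * shift h * u⁻¹) 1 0 = -(u 1 0 ^ 2 * h) := by
      rw [coe_mul_shift_mul_inv]
      rfl
    have hdecr : |(u * shift h * u⁻¹) 1 0| < |u 1 0| := by
      rw [h10, abs_neg, abs_mul, abs_pow, abs_of_pos hh, pow_two, mul_assoc]
      refine mul_lt_of_lt_one_right (abs_pos.mpr huc) (hlt.trans_le' ?_)
      gcongr
    have hle : |(u * shift h * u⁻¹) 1 0| ≤ |s 1 0| := hdecr.le.trans hus
    refine ⟨⟨⟨mul_mem (mul_mem huL hmem) (inv_mem huL), ?_, hle, h00⟩, ?_⟩, hdecr⟩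
    · rw [h10, neg_ne_zero]
      positivity
    · intro i j
      fin_cases i <;> fin_cases j
      · exact h00.trans ((le_max_left _ _).trans (le_max_left _ _))
      · exact h01.trans ((le_max_right _ _).trans (le_max_left _ _))
      · exact hle.trans (le_max_right _ _)
      · exact h11.trans ((le_max_left _ _).trans (le_max_left _ _))
  have hfin : A.Finite := (finite_mem_of_isCompact (L := L) (isCompact_setOf_abs_entry_le N)).subset
    fun u hu ↦ ⟨hu.1.1, hu.2⟩
  obtain ⟨u, hu, hmin⟩ := exists_min_image A (fun u ↦ |u 1 0|) hfin
    ⟨_, (hstep s ⟨hs, hc, le_rfl, le_max_left _ _⟩).1⟩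
  exact (hstep u hu.1).2.not_ge (hmin _ (hstep u hu.1).1)

end Shimizu

section CuspAtInfinity

theorem lower_left_eq_zero_of_lt_im {L : Subgroup SL(2, ℝ)} [DiscreteTopology L] {h : ℝ}
    (hh : 0 < h) (hmem : shift h ∈ L) {s : SL(2, ℝ)} (hs : s ∈ L) {w : ℍ} (hw : h < w.im)
    (hsw : h < ((s : GL (Fin 2) ℝ) • w).im) : s 1 0 = 0 := by
  by_contra hc
  have hch : 1 ≤ (|s 1 0| * h) ^ 2 := one_le_pow₀ (one_le_abs_lower_left_mul hh hmem hs hc)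
  have hdenom : (s 1 0 * w.im) ^ 2 ≤ Complex.normSq (denom (s : GL (Fin 2) ℝ) w) :=
    c_mul_im_sq_le_normSq_denom (s : GL (Fin 2) ℝ) w
  have him : h * Complex.normSq (denom (s : GL (Fin 2) ℝ) w) < w.im := by
    rw [im_smul_eq_div_normSq, lt_div_iff₀ (normSq_denom_pos _ w.im_ne_zero)] at hsw
    simpa using hsw
  have hlt : h * (s 1 0 * w.im) ^ 2 < w.im := him.trans_le' (by gcongr)
  have : h * s 1 0 ^ 2 * w.im < 1 := by
    rw [← mul_lt_iff_lt_one_left w.im_pos]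
    linarith
  have : (|s 1 0| * h) ^ 2 ≤ h * s 1 0 ^ 2 * w.im := by
    rw [mul_pow, sq_abs]
    calc s 1 0 ^ 2 * h ^ 2 = h * s 1 0 ^ 2 * h := by ring
      _ ≤ h * s 1 0 ^ 2 * w.im := by gcongr
  linarith

theorem mul_shift_mul_inv_of_lower_left_eq_zero {s : SL(2, ℝ)} (hs : s 1 0 = 0) (b : ℝ) :
    s * shift b * s⁻¹ = shift (s 0 0 ^ 2 * b) := by
  refine Subtype.ext ?_
  rw [coe_mul_shift_mul_inv, coe_shift, hs]
  simp

theorem one_le_upper_left_sq {L : Subgroup SL(2, ℝ)} {h : ℝ} (hh : 0 < h) (hmem : shift h ∈ L)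
    (hmin : ∀ b > 0, shift b ∈ L → h ≤ b) {s : SL(2, ℝ)} (hs : s ∈ L) (hc : s 1 0 = 0) :
    1 ≤ s 0 0 ^ 2 := by
  have ha : s 0 0 ≠ 0 := by
    intro ha
    have := s.det_coe
    rw [Matrix.det_fin_two, ha, hc] at this
    simp at this
  refine le_of_mul_le_mul_right ?_ hh
  rw [one_mul]
  refine hmin _ (by positivity) ?_
  rw [← mul_shift_mul_inv_of_lower_left_eq_zero hc]
  exact mul_mem (mul_mem hs hmem) (inv_mem hs)

theorem upper_left_sq_eq_one {L : Subgroup SL(2, ℝ)} {h : ℝ} (hh : 0 < h) (hmem : shift h ∈ L)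
    (hmin : ∀ b > 0, shift b ∈ L → h ≤ b) {s : SL(2, ℝ)} (hs : s ∈ L) (hc : s 1 0 = 0) :
    s 0 0 ^ 2 = 1 := by
  have hinv : ((s⁻¹ : SL(2, ℝ)) : Matrix (Fin 2) (Fin 2) ℝ) = !![s 1 1, -s 0 1; -s 1 0, s 0 0] := by
    rw [Matrix.SpecialLinearGroup.coe_inv, Matrix.adjugate_fin_two]
  have ha := one_le_upper_left_sq hh hmem hmin hs hc
  have hd : 1 ≤ s 1 1 ^ 2 := by
    have := one_le_upper_left_sq hh hmem hmin (inv_mem hs) (by rw [hinv]; simpa using hc)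
    rwa [hinv] at this
  have hdet : s 0 0 * s 1 1 = 1 := by
    have := s.det_coe
    rwa [Matrix.det_fin_two, hc, mul_zero, sub_zero] at this
  have hprod : s 0 0 ^ 2 * s 1 1 ^ 2 = 1 := by rw [← mul_pow, hdet, one_pow]
  nlinarith

theorem toPSL_neg (s : SL(2, ℝ)) : toPSL (-s) = toPSL s := by
  refine QuotientGroup.eq.mpr (Subgroup.mem_center_iff.mpr fun g ↦ ?_)
  rw [inv_neg, neg_mul, inv_mul_cancel]
  simp

theorem exists_toPSL_eq_toPSL_shift {s : SL(2, ℝ)} (hc : s 1 0 = 0) (ha : s 0 0 ^ 2 = 1) :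
    ∃ b, toPSL s = toPSL (shift b) := by
  wlog hpos : s 0 0 = 1 generalizing s
  · have hneg : s 0 0 = -1 := (sq_eq_one_iff.mp ha).resolve_left hpos
    rw [← toPSL_neg]
    exact this (by simp [hc]) (by simp [ha]) (by simp [hneg])
  have hdet : s 1 1 = 1 := by
    have := s.det_coe
    rwa [Matrix.det_fin_two, hc, mul_zero, sub_zero, hpos, one_mul] at this
  refine ⟨s 0 1, congrArg toPSL (Subtype.ext ?_)⟩
  rw [Matrix.eta_fin_two (s : Matrix (Fin 2) (Fin 2) ℝ), hc, hpos, hdet, coe_shift]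
  rfl

theorem mem_strictPeriods_matrices {Γ : Subgroup PSL(2, ℝ)} {b : ℝ} :
    b ∈ (matrices Γ).strictPeriods ↔ shift b ∈ preimage Γ := by
  rw [Subgroup.mem_strictPeriods_iff, ← toGL_shift, toGL_mem_matrices]

theorem coe_toPSL_shift_smul (b : ℝ) (w : ℍ) : ((toPSL (shift b) • w : ℍ) : ℂ) = w + b := by
  rw [QuotientGroup.mk'_apply, psl_smul_mk, coe_smul_of_det_pos (by simp), num, denom, toGL_shift]
  simp

theorem strictWidthInfty_le {Γ : Subgroup PSL(2, ℝ)} [DiscreteTopology Γ] {b : ℝ} (hb : 0 < b)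
    (hmem : shift b ∈ preimage Γ) : (matrices Γ).strictWidthInfty ≤ b := by
  rw [← mem_strictPeriods_matrices, Subgroup.strictPeriods_eq_zmultiples_strictWidthInfty,
    AddSubgroup.mem_zmultiples_iff] at hmem
  obtain ⟨n, rfl⟩ := hmem
  have hn : 0 < n := by
    by_contra! hn
    exact hb.not_ge (smul_nonpos_of_nonpos_of_nonneg hn (Subgroup.strictWidthInfty_nonneg _))
  rw [zsmul_eq_mul]
  exact le_mul_of_one_le_left (Subgroup.strictWidthInfty_nonneg _) (by exact_mod_cast hn)

theorem exists_eq_toPSL_shift {Γ : Subgroup PSL(2, ℝ)} [DiscreteTopology Γ]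
    (hcusp : IsCusp OnePoint.infty (matrices Γ)) {γ : PSL(2, ℝ)} (hγ : γ ∈ Γ) {w : ℍ}
    (hw : (matrices Γ).strictWidthInfty < w.im)
    (hγw : (matrices Γ).strictWidthInfty < (γ • w).im) : ∃ b, γ = toPSL (shift b) := by
  obtain ⟨s, rfl⟩ := QuotientGroup.mk'_surjective _ γ
  have hh : 0 < (matrices Γ).strictWidthInfty := Subgroup.strictWidthInfty_pos_iff.mpr hcusp
  have hmem : shift (matrices Γ).strictWidthInfty ∈ preimage Γ :=
    mem_strictPeriods_matrices.mp (Subgroup.strictWidthInfty_mem_strictPeriods _)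
  have hc : s 1 0 = 0 := lower_left_eq_zero_of_lt_im hh hmem hγ hw hγw
  exact exists_toPSL_eq_toPSL_shift hc
    (upper_left_sq_eq_one hh hmem (fun b ↦ strictWidthInfty_le) hγ hc)

end CuspAtInfinity

section Invariance

instance : ContinuousConstSMul PSL(2, ℝ) ℍ where
  continuous_const_smul := QuotientGroup.mk'_surjective _ |>.forall.mpr fun s ↦
    continuous_const_smul (s : GL (Fin 2) ℝ)

instance : SMulInvariantMeasure PSL(2, ℝ) ℍ volume where
  measure_preimage_smul := QuotientGroup.mk'_surjective _ |>.forall.mpr fun s _ hA ↦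
    measure_preimage_smul_of_nullMeasurableSet hA.nullMeasurableSet (s : GL (Fin 2) ℝ)

theorem norm_weighted_sq (k : ℕ) (f : ℍ → ℂ) (z : ℍ) :
    ‖weighted k f z‖ ^ 2 = ‖petersson (2 * (k : ℤ)) f f z‖ := by
  have him : (z.im : ℂ) ^ (2 * (k : ℤ)) = (z.im : ℂ) ^ (2 * k) := by norm_cast
  rw [petersson, him, norm_mul, norm_mul, RCLike.norm_conj, weighted, norm_mul, norm_pow, norm_pow]
  ring

theorem enorm_weighted_slash (k : ℕ) (f : ℍ → ℂ) (s : SL(2, ℝ)) (z : ℍ) :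
    ‖weighted k (f ∣[2 * (k : ℤ)] (s : GL (Fin 2) ℝ)) z‖ₑ = ‖weighted k f (toPSL s • z)‖ₑ := by
  rw [enorm_eq_iff_norm_eq, ← sq_eq_sq₀ (norm_nonneg _) (norm_nonneg _), norm_weighted_sq,
    norm_weighted_sq, petersson_slash, QuotientGroup.mk'_apply, psl_smul_mk]
  simp

theorem enorm_weighted_smul {Γ : Subgroup PSL(2, ℝ)} {k : ℕ} (f : CuspForms Γ k) {γ : PSL(2, ℝ)}
    (hγ : γ ∈ Γ) (z : ℍ) : ‖weighted k f (γ • z)‖ₑ = ‖weighted k f z‖ₑ := by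
  obtain ⟨s, rfl⟩ := QuotientGroup.mk'_surjective _ γ
  rw [← enorm_weighted_slash, SlashInvariantFormClass.slash_action_eq f _
    (toGL_mem_matrices.mpr hγ)]

end Invariance

section UniformBoundAt

/-- The square of the Petersson norm of `f`, computed over the fundamental domain `F`. -/
noncomputable def peterssonNormSq (F : Set ℍ) (k : ℕ) (f : ℍ → ℂ) : ℝ≥0∞ :=
  ∫⁻ z in F, ‖weighted k f z‖ₑ ^ 2

/-- At the point `z`, every cusp form `f` of weight `2k` for a subgroup of `Γ₀` satisfies
`|f(z)|² Im(z)^{2k} ≤ C k^{3/2} ‖f‖²`. Subgroups of infinite index are included: this costs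
nothing, as the constant counts elements of `Γ₀`. -/
def UniformBoundAt (Γ₀ : Subgroup PSL(2, ℝ)) (C : ℝ≥0) (z : ℍ) : Prop :=
  ∀ Γ ≤ Γ₀, ∀ k > 0, ∀ F : Set ℍ, IsFundamentalDomain Γ F volume → ∀ f : CuspForms Γ k,
    ‖weighted k f z‖ₑ ^ 2 ≤ ENNReal.ofReal (C * (k : ℝ) ^ (3 / 2 : ℝ)) * peterssonNormSq F k f

variable {Γ Γ₀ : Subgroup PSL(2, ℝ)} {C C' : ℝ≥0} {k : ℕ} {F : Set ℍ} {z : ℍ}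

theorem UniformBoundAt.mono (h : UniformBoundAt Γ₀ C z) (hC : C ≤ C') :
    UniformBoundAt Γ₀ C' z := by
  intro Γ hΓ k hk F hF f
  refine (h Γ hΓ k hk F hF f).trans ?_
  gcongr

theorem rpow_three_halves {x : ℝ} (hx : 0 ≤ x) : x ^ (3 / 2 : ℝ) = x * √x := by
  rw [Real.sqrt_eq_rpow, ← Real.rpow_one_add' hx (by norm_num)]
  norm_num

theorem enorm_weighted_sq_le_mul_peterssonNormSq [Countable Γ] (hk : 0 < k)
    (hF : IsFundamentalDomain Γ F volume) (f : CuspForms Γ k) {t : Finset PSL(2, ℝ)}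
    (ht : ∀ γ ∈ Γ, ∀ w ∈ weightDisc k z, γ • w ∈ weightDisc k z → γ ∈ t) {c : ℝ}
    (hc : 9 * k * t.card ≤ c) :
    ‖weighted k f z‖ₑ ^ 2 ≤ ENNReal.ofReal c * peterssonNormSq F k f := by
  have hmeas : Measurable fun w ↦ ‖weighted k f w‖ₑ ^ 2 :=
    (continuous_weighted k (CuspFormClass.holo f).continuous).measurable.enorm.pow_const 2
  have hinv : ∀ γ ∈ Γ, ∀ w, ‖weighted k f (γ • w)‖ₑ ^ 2 = ‖weighted k f w‖ₑ ^ 2 :=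
    fun γ hγ w ↦ by rw [enorm_weighted_smul f hγ]
  calc ‖weighted k f z‖ₑ ^ 2
      ≤ ENNReal.ofReal (9 * k) * ∫⁻ w in weightDisc k z, ‖weighted k f w‖ₑ ^ 2 :=
        enorm_weighted_sq_le_lintegral hk (CuspFormClass.holo f) z
    _ ≤ ENNReal.ofReal (9 * k) * (t.card * peterssonNormSq F k f) := by
        gcongr
        exact setLIntegral_le_card_mul hF hmeas hinv (measurableSet_weightDisc k z) ht
    _ = ENNReal.ofReal (9 * k * t.card) * peterssonNormSq F k f := by
        rw [← mul_assoc, ← ENNReal.ofReal_natCast, ← ENNReal.ofReal_mul (by positivity)]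
    _ ≤ ENNReal.ofReal c * peterssonNormSq F k f := by gcongr

end UniformBoundAt

section Conjugation

variable {Γ Γ₀ : Subgroup PSL(2, ℝ)} {C : ℝ≥0} {k : ℕ} {F : Set ℍ} {z : ℍ}

theorem matrices_conj_smul (s : SL(2, ℝ)) (Γ : Subgroup PSL(2, ℝ)) :
    matrices (MulAut.conj (toPSL s) • Γ) =
      ConjAct.toConjAct (s : GL (Fin 2) ℝ) • matrices Γ := by
  have hmem (r : SL(2, ℝ)) : r ∈ preimage (MulAut.conj (toPSL s) • Γ) ↔
      s⁻¹ * r * s ∈ preimage Γ := by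
    rw [Subgroup.mem_comap, Subgroup.mem_pointwise_smul_iff_inv_smul_mem]
    simp
  ext x
  rw [Subgroup.mem_pointwise_smul_iff_inv_smul_mem, ← ConjAct.toConjAct_inv,
    ConjAct.toConjAct_smul, inv_inv]
  constructor
  · rintro ⟨r, hr, rfl⟩
    rw [← map_inv, ← map_mul, ← map_mul, toGL_mem_matrices]
    exact (hmem r).mp hr
  · rintro ⟨r, hr, hrx⟩
    refine ⟨s * r * s⁻¹, (hmem _).mpr (by simpa [mul_assoc] using hr), ?_⟩
    rw [map_mul, map_mul, map_inv, hrx]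
    group

instance (γ : PSL(2, ℝ)) (Γ : Subgroup PSL(2, ℝ)) [DiscreteTopology Γ] :
    DiscreteTopology (MulAut.conj γ • Γ : Subgroup PSL(2, ℝ)) := by
  have hmem (x : (MulAut.conj γ • Γ : Subgroup PSL(2, ℝ))) : γ⁻¹ * x * γ ∈ Γ := by
    simpa using Subgroup.mem_pointwise_smul_iff_inv_smul_mem.mp x.2
  refine DiscreteTopology.of_continuous_injective (f := fun x ↦ (⟨_, hmem x⟩ : Γ)) ?_ ?_
  · exact Continuous.subtype_mk (by fun_prop) _
  · intro x y hxy
    simpa using congrArg Subtype.val hxy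

theorem isFundamentalDomain_preimage_smul (hF : IsFundamentalDomain Γ F volume) (γ : PSL(2, ℝ)) :
    IsFundamentalDomain (MulAut.conj γ⁻¹ • Γ : Subgroup PSL(2, ℝ)) ((γ • · : ℍ → ℍ) ⁻¹' F)
      volume := by
  refine hF.preimage_of_equiv (measurePreserving_smul γ volume).quasiMeasurePreserving
    (Subgroup.equivSMul (MulAut.conj γ⁻¹) Γ).bijective fun g z ↦ ?_
  change γ • (γ⁻¹ * g * γ⁻¹⁻¹) • z = (g : PSL(2, ℝ)) • γ • z
  simp [mul_smul]

theorem peterssonNormSq_preimage_smul {f f' : ℍ → ℂ} {γ : PSL(2, ℝ)}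
    (hf : ∀ z, ‖weighted k f' z‖ₑ = ‖weighted k f (γ • z)‖ₑ) :
    peterssonNormSq ((γ • · : ℍ → ℍ) ⁻¹' F) k f' = peterssonNormSq F k f := by
  simp only [peterssonNormSq, hf]
  exact (measurePreserving_smul γ volume).setLIntegral_comp_preimage_emb
    (measurableEmbedding_const_smul γ) (fun z ↦ ‖weighted k f z‖ₑ ^ 2) F

theorem exists_cuspForm_enorm_weighted_eq (f : CuspForms Γ k) (γ : PSL(2, ℝ)) :
    ∃ f' : CuspForms (MulAut.conj γ⁻¹ • Γ) k,
      ∀ z, ‖weighted k f' z‖ₑ = ‖weighted k f (γ • z)‖ₑ := by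
  obtain ⟨s, rfl⟩ := QuotientGroup.mk'_surjective _ γ
  obtain ⟨f', hf'⟩ : ∃ f' : CuspForms (MulAut.conj (toPSL s)⁻¹ • Γ) k,
      ⇑f' = ⇑f ∣[2 * (k : ℤ)] (s : GL (Fin 2) ℝ) := by
    rw [← map_inv]
    unfold CuspForms
    rw [matrices_conj_smul, map_inv]
    exact ⟨CuspForm.translate f (s : GL (Fin 2) ℝ), rfl⟩
  exact ⟨f', fun z ↦ by rw [hf', enorm_weighted_slash]⟩

theorem UniformBoundAt.smul {γ : PSL(2, ℝ)} (h : UniformBoundAt (MulAut.conj γ⁻¹ • Γ₀) C z) :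
    UniformBoundAt Γ₀ C (γ • z) := by
  intro Γ hΓ k hk F hF f
  obtain ⟨f', hf'⟩ := exists_cuspForm_enorm_weighted_eq f γ
  have := h _ (Subgroup.pointwise_smul_le_pointwise_smul_iff.mpr hΓ) k hk _
    (isFundamentalDomain_preimage_smul hF γ) f'
  rwa [peterssonNormSq_preimage_smul hf', hf'] at this

theorem UniformBoundAt.smul_of_mem (h : UniformBoundAt Γ₀ C z) {γ : PSL(2, ℝ)} (hγ : γ ∈ Γ₀) :
    UniformBoundAt Γ₀ C (γ • z) :=
  UniformBoundAt.smul (by rwa [Subgroup.conj_smul_eq_self_of_mem (inv_mem hγ)])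

end Conjugation

section WeightDisc

variable {k : ℕ} {z w w' : ℍ}

theorem dist_coe_lt_half_im_of_mem_weightDisc (hk : 0 < k) (hw : w ∈ weightDisc k z) :
    dist (w : ℂ) z < z.im / 2 := by
  have hsqrt : 1 ≤ √(k : ℝ) := Real.one_le_sqrt.mpr (by exact_mod_cast hk)
  have := z.im_pos
  refine lt_of_lt_of_le hw ?_
  gcongr
  linarith

theorem half_im_lt_of_mem_weightDisc (hk : 0 < k) (hw : w ∈ weightDisc k z) :
    z.im / 2 < w.im := by
  have hdist := dist_coe_lt_half_im_of_mem_weightDisc hk hw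
  rw [dist_eq_norm] at hdist
  have him := (Complex.abs_im_le_norm ((w : ℂ) - z)).trans_lt hdist
  rw [Complex.sub_im, coe_im, coe_im, abs_lt] at him
  linarith

theorem weightDisc_subset_ball (hk : 0 < k) (z : ℍ) : weightDisc k z ⊆ ball z 1 := by
  intro w hw
  have hz := z.im_pos
  have him := half_im_lt_of_mem_weightDisc hk hw
  have hsqrt : z.im / 2 ≤ √(w.im * z.im) := Real.le_sqrt_of_sq_le (by nlinarith)
  refine (dist_le_dist_coe_div_sqrt w z).trans_lt ?_
  rw [div_lt_one (by positivity)]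
  exact (dist_coe_lt_half_im_of_mem_weightDisc hk hw).trans_le hsqrt

theorem dist_coe_le_of_mem_weightDisc (hw : w ∈ weightDisc k z) (hw' : w' ∈ weightDisc k z) :
    dist (w' : ℂ) w ≤ z.im / √k :=
  calc dist (w' : ℂ) w ≤ dist (w' : ℂ) z + dist (w : ℂ) z := dist_triangle_right _ _ _
    _ ≤ z.im / (2 * √k) + z.im / (2 * √k) := add_le_add (le_of_lt hw') (le_of_lt hw)
    _ = z.im / √k := by rw [mul_comm, ← div_div, add_halves]

end WeightDisc

section LocalBounds

variable {Γ Γ₀ : Subgroup PSL(2, ℝ)} {k : ℕ} {F : Set ℍ}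

theorem discreteTopology_of_le [DiscreteTopology Γ₀] (hΓ : Γ ≤ Γ₀) : DiscreteTopology Γ :=
  .of_continuous_injective (continuous_inclusion hΓ) (inclusion_injective hΓ)

theorem finite_setOf_smul_mem_of_isCompact (Γ : Subgroup PSL(2, ℝ)) [DiscreteTopology Γ] {K : Set ℍ}
    (hK : IsCompact K) : {γ ∈ Γ | ∃ w ∈ K, γ • w ∈ K}.Finite := by
  have hfin : {s : preimage Γ | ((s • ·) '' K ∩ K).Nonempty}.Finite :=
    finite_disjoint_inter_image hK hK
  refine (hfin.image fun s : preimage Γ ↦ toPSL s).subset ?_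
  rintro γ ⟨hγ, w, hw, hγw⟩
  obtain ⟨s, rfl⟩ := QuotientGroup.mk'_surjective _ γ
  exact ⟨⟨s, hγ⟩, ⟨_, ⟨w, hw, rfl⟩, hγw⟩, rfl⟩

theorem exists_uniformBoundAt_of_mem_ball (Γ₀ : Subgroup PSL(2, ℝ)) [DiscreteTopology Γ₀] (z₀ : ℍ) :
    ∃ C, ∀ z ∈ ball z₀ 1, UniformBoundAt Γ₀ C z := by
  have hfin := finite_setOf_smul_mem_of_isCompact Γ₀ (isCompact_closedBall z₀ 2)
  refine ⟨9 * hfin.toFinset.card, fun z hz Γ hΓ k hk F hF f ↦ ?_⟩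
  have := discreteTopology_of_le hΓ
  have hsub : weightDisc k z ⊆ closedBall z₀ 2 :=
    calc weightDisc k z ⊆ ball z 1 := weightDisc_subset_ball hk z
      _ ⊆ ball z₀ 2 := ball_subset_ball' (by linarith [mem_ball.mp hz])
      _ ⊆ closedBall z₀ 2 := ball_subset_closedBall
  refine enorm_weighted_sq_le_mul_peterssonNormSq hk hF f (t := hfin.toFinset)
    (fun γ hγ w hw hγw ↦ hfin.mem_toFinset.mpr ⟨hΓ hγ, w, hsub hw, hsub hγw⟩) ?_
  have hsqrt : 1 ≤ √(k : ℝ) := Real.one_le_sqrt.mpr (by exact_mod_cast hk)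
  rw [rpow_three_halves (by positivity)]
  push_cast
  calc 9 * (k : ℝ) * hfin.toFinset.card = 9 * hfin.toFinset.card * (k * 1) := by ring
    _ ≤ 9 * hfin.toFinset.card * (k * √k) := by gcongr

theorem card_image_Icc_floor_le {α : Type*} [DecidableEq α] (e : ℤ → α) {q : ℝ} (hq : 0 ≤ q) :
    (((Finset.Icc (-⌊q⌋) ⌊q⌋).image e).card : ℝ) ≤ 2 * q + 1 := by
  have hfloor : 0 ≤ ⌊q⌋ := Int.floor_nonneg.mpr hq
  have hcard : (((Finset.Icc (-⌊q⌋) ⌊q⌋).image e).card : ℤ) ≤ 2 * ⌊q⌋ + 1 := by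
    have := Finset.card_image_le (s := Finset.Icc (-⌊q⌋) ⌊q⌋) (f := e)
    rw [Int.card_Icc] at this
    omega
  calc (((Finset.Icc (-⌊q⌋) ⌊q⌋).image e).card : ℝ) ≤ 2 * ⌊q⌋ + 1 := by exact_mod_cast hcard
    _ ≤ 2 * q + 1 := by gcongr; exact Int.floor_le q

theorem enorm_weighted_sq_le_of_im_le [DiscreteTopology Γ₀]
    (hcusp : IsCusp OnePoint.infty (matrices Γ₀)) (hΓ : Γ ≤ Γ₀) (hk : 0 < k)
    (hF : IsFundamentalDomain Γ F volume) (f : CuspForms Γ k) {h : ℝ} (hh : 0 < h)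
    (hper : (matrices Γ).strictPeriods ≤ AddSubgroup.zmultiples h) {z : ℍ}
    (hz : 2 * (matrices Γ₀).strictWidthInfty ≤ z.im) (hzh : z.im ≤ 2 * k * h) :
    ‖weighted k f z‖ₑ ^ 2 ≤
      ENNReal.ofReal (45 * (k : ℝ) ^ (3 / 2 : ℝ)) * peterssonNormSq F k f := by
  classical
  have := discreteTopology_of_le hΓ
  have := z.im_pos
  set q : ℝ := z.im / √k / h with hq
  have hsqrt : 1 ≤ √(k : ℝ) := Real.one_le_sqrt.mpr (by exact_mod_cast hk)
  have hqk : q ≤ 2 * √k := by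
    rw [hq, div_le_iff₀ hh, div_le_iff₀ (by positivity)]
    refine hzh.trans_eq ?_
    nth_rw 1 [← Real.mul_self_sqrt k.cast_nonneg]
    ring
  refine enorm_weighted_sq_le_mul_peterssonNormSq hk hF f
    (t := (Finset.Icc (-⌊q⌋) ⌊q⌋).image fun n : ℤ ↦ toPSL (shift (n • h)))
    (fun γ hγ w hw hγw ↦ ?_) ?_
  · obtain ⟨b, rfl⟩ := exists_eq_toPSL_shift hcusp (hΓ hγ) (w := w)
      (by linarith [half_im_lt_of_mem_weightDisc hk hw])
      (by linarith [half_im_lt_of_mem_weightDisc hk hγw])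
    obtain ⟨n, rfl⟩ := AddSubgroup.mem_zmultiples_iff.mp
      (hper (mem_strictPeriods_matrices.mpr hγ))
    refine Finset.mem_image_of_mem _ ?_
    have hdist := dist_coe_le_of_mem_weightDisc hw hγw
    rw [coe_toPSL_shift_smul, dist_self_add_left, Complex.norm_real, zsmul_eq_mul, norm_mul,
      Real.norm_of_nonneg hh.le, ← le_div_iff₀ hh, Real.norm_eq_abs] at hdist
    rwa [Finset.mem_Icc, ← abs_le, Int.le_floor, Int.cast_abs]
  · rw [rpow_three_halves (by positivity)]
    calc 9 * (k : ℝ) * ((Finset.Icc (-⌊q⌋) ⌊q⌋).image _).card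
        ≤ 9 * k * (2 * q + 1) := by
          gcongr
          exact card_image_Icc_floor_le _ (by positivity)
      _ ≤ 9 * k * (5 * √k) := by gcongr; linarith
      _ = 45 * (k * √k) := by ring

theorem enorm_weighted_sq_le_of_horocycle [DiscreteTopology Γ]
    (hcusp : IsCusp OnePoint.infty (matrices Γ)) (f : CuspForms Γ k) {Y : ℝ} (hY : 0 < Y)
    (hkY : k * (matrices Γ).strictWidthInfty ≤ 2 * π * Y) {A : ℝ≥0∞}
    (hA : ∀ z : ℍ, z.im = Y → ‖weighted k f z‖ₑ ^ 2 ≤ A) {z : ℍ} (hz : Y ≤ z.im) :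
    ‖weighted k f z‖ₑ ^ 2 ≤ A := by
  induction A with
  | top => exact le_top
  | coe A =>
    have henorm (w : ℍ) : ‖weighted k f w‖ₑ ^ 2 ≤ A ↔ ‖weighted k f w‖ ≤ √(A : ℝ) := by
      rw [Real.le_sqrt (norm_nonneg _) A.coe_nonneg, ← coe_nnnorm, enorm_eq_nnnorm]
      norm_cast
    rw [henorm]
    refine norm_weighted_le_of_horocycle (Subgroup.strictWidthInfty_pos_iff.mpr hcusp)
      (SlashInvariantFormClass.periodic_comp_ofComplex f
        (Subgroup.strictWidthInfty_mem_strictPeriods _))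
      (CuspFormClass.holo f) ?_ hY hkY (fun w hw ↦ (henorm w).mp (hA w hw)) hz
    simpa using CuspFormClass.zero_at_cusps f hcusp 1 (one_smul _ _)

theorem uniformBoundAt_of_isCusp_infty [DiscreteTopology Γ₀]
    (hcusp : IsCusp OnePoint.infty (matrices Γ₀)) {z : ℍ}
    (hz : 2 * (matrices Γ₀).strictWidthInfty ≤ z.im) : UniformBoundAt Γ₀ 45 z := by
  intro Γ hΓ k hk F hF f
  have := discreteTopology_of_le hΓ
  have hk' : (1 : ℝ) ≤ k := by exact_mod_cast hk
  have hperiods := (matrices Γ).strictPeriods_eq_zmultiples_strictWidthInfty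
  by_cases hcusp' : IsCusp OnePoint.infty (matrices Γ)
  · set h := (matrices Γ).strictWidthInfty
    have hh : 0 < h := Subgroup.strictWidthInfty_pos_iff.mpr hcusp'
    have hwidth : (matrices Γ₀).strictWidthInfty ≤ h :=
      strictWidthInfty_le hh (hΓ (mem_strictPeriods_matrices.mp
        (Subgroup.strictWidthInfty_mem_strictPeriods _)))
    rcases le_total z.im (2 * k * h) with hzh | hzh
    · exact enorm_weighted_sq_le_of_im_le hcusp hΓ hk hF f hh hperiods.le hz hzh
    · refine enorm_weighted_sq_le_of_horocycle hcusp' f (Y := 2 * k * h) (by positivity) ?_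
        (fun w hw ↦ ?_) hzh
      · nlinarith [Real.pi_gt_three, mul_pos (zero_lt_one.trans_le hk') hh]
      · refine enorm_weighted_sq_le_of_im_le hcusp hΓ hk hF f hh hperiods.le ?_ hw.le
        rw [hw]
        nlinarith
  · have hwidth : (matrices Γ).strictWidthInfty = 0 :=
      (Subgroup.strictWidthInfty_nonneg _).antisymm'
        (not_lt.mp (mt Subgroup.strictWidthInfty_pos_iff.mp hcusp'))
    refine enorm_weighted_sq_le_of_im_le hcusp hΓ hk hF f z.im_pos ?_ hz ?_
    · simp [hperiods, hwidth]
    · nlinarith [z.im_pos]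

theorem isCusp_infty_matrices_conj {s : SL(2, ℝ)}
    (hcusp : IsCusp ((s : GL (Fin 2) ℝ) • OnePoint.infty) (matrices Γ₀)) :
    IsCusp OnePoint.infty (matrices (MulAut.conj (toPSL s)⁻¹ • Γ₀)) := by
  rw [← map_inv, matrices_conj_smul]
  simpa using hcusp.smul ((s⁻¹ : SL(2, ℝ)) : GL (Fin 2) ℝ)

theorem exists_uniformBoundAt_horoball [DiscreteTopology Γ₀] {s : SL(2, ℝ)}
    (hcusp : IsCusp ((s : GL (Fin 2) ℝ) • OnePoint.infty) (matrices Γ₀)) :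
    ∃ T, ∀ z : ℍ, T < z.im → UniformBoundAt Γ₀ 45 (toPSL s • z) :=
  ⟨_, fun _ hz ↦ (uniformBoundAt_of_isCusp_infty (isCusp_infty_matrices_conj hcusp) hz.le).smul⟩

end LocalBounds

section Cover

theorem exists_forall_mem_of_monotone {X ι : Type*} [TopologicalSpace X] {r : Setoid X}
    [CompactSpace (Quotient r)] [Preorder ι] [IsDirectedOrder ι] [Nonempty ι] {O : ι → Set X}
    (hopen : ∀ i, IsOpen (O i)) (hmono : Monotone O)
    (hsat : ∀ i x y, r x y → x ∈ O i → y ∈ O i) (hcover : ∀ x, ∃ i, x ∈ O i) :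
    ∃ i, ∀ x, x ∈ O i := by
  let V (i : ι) : Set (Quotient r) := {q | q.lift (· ∈ O i)
    fun x y h ↦ propext ⟨hsat i x y h, hsat i y x (r.symm h)⟩}
  have hV (i) : IsOpen (V i) := isQuotientMap_quotient_mk'.isOpen_preimage.mp (hopen i)
  have hVmono : Monotone V := fun i j hij ↦ Quotient.ind fun x hx ↦ hmono hij hx
  obtain ⟨i, hi⟩ := isCompact_univ.elim_directed_cover V hV
    (fun q _ ↦ q.ind fun x ↦ mem_iUnion.mpr (hcover x)) hVmono.directed_le
  exact ⟨i, fun x ↦ hi (mem_univ ⟦x⟧)⟩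

/-- The points of the extended plane near which `UniformBoundAt Γ₀ C` holds; all cusps are
included, as every cusp has a neighbourhood where the bound holds as soon as `45 ≤ C`. -/
def boundLocus (Γ₀ : Subgroup PSL(2, ℝ)) (C : ℝ≥0) : Set (ExtendedPlane (matrices Γ₀)) :=
  {x | ∀ z, x = .point z → ∀ᶠ w in 𝓝 z, UniformBoundAt Γ₀ C w}

variable {Γ₀ : Subgroup PSL(2, ℝ)} {C : ℝ≥0}

theorem point_mem_boundLocus {z : ℍ} :
    .point z ∈ boundLocus Γ₀ C ↔ ∀ᶠ w in 𝓝 z, UniformBoundAt Γ₀ C w :=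
  ⟨fun h ↦ h z rfl, by rintro h _ ⟨⟩; exact h⟩

theorem isOpen_boundLocus [DiscreteTopology Γ₀] (hC : 45 ≤ C) : IsOpen (boundLocus Γ₀ C) := by
  refine ⟨?_, fun c _ s hs ↦ ?_⟩
  · simp only [point_mem_boundLocus]
    exact isOpen_setOfPred_eventually_nhds
  · obtain ⟨T, hT⟩ := exists_uniformBoundAt_horoball (s := s) (hs ▸ c.2)
    refine ⟨T, fun z hz ↦ point_mem_boundLocus.mpr ?_⟩
    change ∀ᶠ w in 𝓝 (toPSL s • z), UniformBoundAt Γ₀ C w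
    rw [nhds_smul]
    exact (continuous_im.continuousAt.eventually_const_lt hz).mono fun w hw ↦ (hT w hw).mono hC

theorem smul_mem_boundLocus {x : ExtendedPlane (matrices Γ₀)} (g : matrices Γ₀)
    (hx : x ∈ boundLocus Γ₀ C) : g • x ∈ boundLocus Γ₀ C := by
  obtain ⟨_, s, hs, rfl⟩ := g
  cases x with
  | cusp c => rintro z ⟨⟩
  | point z =>
    refine point_mem_boundLocus.mpr ?_
    change ∀ᶠ w in 𝓝 (toPSL s • z), UniformBoundAt Γ₀ C w
    rw [nhds_smul]
    exact (point_mem_boundLocus.mp hx).mono fun w hw ↦ hw.smul_of_mem hs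

theorem exists_uniformBoundAt (hΓ₀ : IsFirstKind Γ₀) : ∃ C, ∀ z, UniformBoundAt Γ₀ C z := by
  have := hΓ₀.discrete
  have := hΓ₀.compact_quotient
  have hmono : Monotone fun C ↦ boundLocus Γ₀ (45 + C) := fun C D hCD x hx z hz ↦
    (hx z hz).mono fun w hw ↦ hw.mono (by gcongr)
  have hsat (C : ℝ≥0) (x y : ExtendedPlane (matrices Γ₀))
      (hxy : MulAction.orbitRel (matrices Γ₀) _ x y) (hx : x ∈ boundLocus Γ₀ (45 + C)) :
      y ∈ boundLocus Γ₀ (45 + C) := by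
    obtain ⟨g, rfl⟩ := hxy
    simpa using smul_mem_boundLocus g⁻¹ hx
  have hcover (x : ExtendedPlane (matrices Γ₀)) : ∃ C, x ∈ boundLocus Γ₀ (45 + C) := by
    cases x with
    | cusp c => exact ⟨0, by rintro z ⟨⟩⟩
    | point z =>
      obtain ⟨C, hC⟩ := exists_uniformBoundAt_of_mem_ball Γ₀ z
      refine ⟨C, point_mem_boundLocus.mpr ?_⟩
      filter_upwards [ball_mem_nhds z one_pos] with w hw
      exact (hC w hw).mono le_add_self
  obtain ⟨C, hC⟩ := exists_forall_mem_of_monotone (fun C ↦ isOpen_boundLocus le_self_add) hmono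
    hsat hcover
  exact ⟨45 + C, fun z ↦ (point_mem_boundLocus.mp (hC (.point z))).self_of_nhds⟩

end Cover

section Bessel

variable {α ι 𝕜 : Type*} [MeasurableSpace α] {μ : Measure α} [DecidableEq ι] [RCLike 𝕜]

theorem memLp_two_of_integral_mul_conj_ne_zero {u : α → 𝕜} (hu : AEStronglyMeasurable u μ)
    (h : ∫ x, u x * conj (u x) ∂μ ≠ 0) : MemLp u 2 μ := by
  rw [memLp_two_iff_integrable_sq_norm hu]
  have hint : Integrable (fun x ↦ u x * conj (u x)) μ := not_imp_comm.mp integral_undef h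
  refine hint.norm.congr (ae_of_all _ fun x ↦ ?_)
  simp [sq]

theorem orthonormal_toLp {u : ι → α → 𝕜} (hu : ∀ i, MemLp (u i) 2 μ)
    (horth : ∀ i j, ∫ x, u i x * conj (u j x) ∂μ = if i = j then 1 else 0) :
    Orthonormal 𝕜 fun i ↦ (hu i).toLp (u i) := by
  rw [orthonormal_iff_ite]
  intro i j
  rw [L2.inner_def]
  calc ∫ x, inner 𝕜 ((hu i).toLp (u i) x) ((hu j).toLp (u j) x) ∂μ
      = ∫ x, u j x * conj (u i x) ∂μ := by
        refine integral_congr_ae ?_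
        filter_upwards [(hu i).coeFn_toLp, (hu j).coeFn_toLp] with x hi hj
        rw [hi, hj, RCLike.inner_apply]
    _ = if i = j then 1 else 0 := by rw [horth]; simp only [eq_comm]

theorem lintegral_enorm_sum_sq [Fintype ι] {u : ι → α → 𝕜} (hu : ∀ i, AEStronglyMeasurable (u i) μ)
    (horth : ∀ i j, ∫ x, u i x * conj (u j x) ∂μ = if i = j then 1 else 0) (c : ι → 𝕜) :
    ∫⁻ x, ‖∑ i, c i * u i x‖ₑ ^ 2 ∂μ = ENNReal.ofReal (∑ i, ‖c i‖ ^ 2) := by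
  have hLp (i) : MemLp (u i) 2 μ :=
    memLp_two_of_integral_mul_conj_ne_zero (hu i) (by simp [horth])
  set v : Lp 𝕜 2 μ := ∑ i, c i • (hLp i).toLp (u i)
  have hae : ⇑v =ᵐ[μ] fun x ↦ ∑ i, c i * u i x := by
    have hterm : ∀ᵐ x ∂μ, ∀ i, (c i • (hLp i).toLp (u i) : Lp 𝕜 2 μ) x = c i * u i x :=
      ae_all_iff.mpr fun i ↦ by
        filter_upwards [Lp.coeFn_smul (c i) ((hLp i).toLp (u i)), (hLp i).coeFn_toLp] with x hc hx
        rw [hc, Pi.smul_apply, hx, smul_eq_mul]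
    filter_upwards [Lp.coeFn_fun_finsetSum Finset.univ fun i ↦ c i • (hLp i).toLp (u i),
      hterm] with x hsum hx
    rw [hsum]
    exact Finset.sum_congr rfl fun i _ ↦ hx i
  have hnorm : ‖v‖ ^ 2 = ∑ i, ‖c i‖ ^ 2 := by
    simpa using (orthonormal_toLp hLp horth).orthogonalFamily.norm_sum c Finset.univ
  calc ∫⁻ x, ‖∑ i, c i * u i x‖ₑ ^ 2 ∂μ
      = ∫⁻ x, ‖v x‖ₑ ^ 2 ∂μ := lintegral_congr_ae (hae.mono fun x hx ↦ by simp only [hx])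
    _ = eLpNorm v 2 μ ^ 2 := by
      simpa using (eLpNorm_nnreal_pow_eq_lintegral (f := v) (μ := μ) (two_ne_zero (α := ℝ≥0))).symm
    _ = ENNReal.ofReal (∑ i, ‖c i‖ ^ 2) := by
      rw [← Lp.enorm_def, ← hnorm, ENNReal.ofReal_pow (norm_nonneg _), ofReal_norm]

end Bessel

section SumSq

variable {Γ : Subgroup PSL(2, ℝ)} {k d : ℕ} {F : Set ℍ} {f : Fin d → CuspForms Γ k}

theorem weighted_mul_conj_weighted (k : ℕ) (f g : ℍ → ℂ) (z : ℍ) :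
    weighted k f z * conj (weighted k g z) = f z * conj (g z) * (z.im : ℂ) ^ (2 * k) := by
  simp only [weighted, map_mul, map_pow, Complex.conj_ofReal]
  ring

theorem sumSq_eq_sum_norm_weighted_sq (f : Fin d → CuspForms Γ k) (z : ℍ) :
    sumSq f z = ∑ i, ‖weighted k (f i) z‖ ^ 2 := by
  refine Finset.sum_congr rfl fun i _ ↦ ?_
  rw [norm_weighted, mul_pow, ← pow_mul, mul_comm k]

theorem weighted_sum_smul (c : Fin d → ℂ) (z : ℍ) :
    weighted k (∑ i, c i • f i : CuspForms Γ k) z = ∑ i, c i * weighted k (f i) z := by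
  simp [weighted, Finset.sum_mul, mul_assoc]

theorem peterssonNormSq_sum_smul
    (horth : ∀ i j, peterssonInner F (f i) (f j) = if i = j then 1 else 0) (c : Fin d → ℂ) :
    peterssonNormSq F k (∑ i, c i • f i : CuspForms Γ k) = ENNReal.ofReal (∑ i, ‖c i‖ ^ 2) := by
  simp only [peterssonNormSq, weighted_sum_smul]
  refine lintegral_enorm_sum_sq (fun i ↦ ?_) (fun i j ↦ ?_) c
  · exact (continuous_weighted k (CuspFormClass.holo (f i)).continuous).aestronglyMeasurable
  · simp only [weighted_mul_conj_weighted]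
    exact horth i j

theorem sumSq_le (horth : ∀ i j, peterssonInner F (f i) (f j) = if i = j then 1 else 0) {z : ℍ}
    {B : ℝ} (hB : 0 ≤ B)
    (hbound : ∀ g : CuspForms Γ k,
      ‖weighted k g z‖ₑ ^ 2 ≤ ENNReal.ofReal B * peterssonNormSq F k g) :
    sumSq f z ≤ B := by
  -- Apply the bound to `g = ∑ conj(u_i(z)) f_i`, where `u_i = f_i y^k`: both its weighted value at
  -- `z` and the square of its norm are equal to `S = sumSq f z`, so that `S² ≤ B S`.
  set c : Fin d → ℂ := fun i ↦ conj (weighted k (f i) z)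
  have hS : 0 ≤ sumSq f z := by
    rw [sumSq_eq_sum_norm_weighted_sq]
    positivity
  have hnorm :
      peterssonNormSq F k (∑ i, c i • f i : CuspForms Γ k) = ENNReal.ofReal (sumSq f z) := by
    rw [peterssonNormSq_sum_smul horth, sumSq_eq_sum_norm_weighted_sq]
    simp only [c, RCLike.norm_conj]
  have hval : weighted k (∑ i, c i • f i : CuspForms Γ k) z = (sumSq f z : ℂ) := by
    rw [weighted_sum_smul, sumSq_eq_sum_norm_weighted_sq, Complex.ofReal_sum]
    simp only [c, Complex.conj_mul', Complex.ofReal_pow]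
  have hsq := hbound (∑ i, c i • f i)
  rw [hnorm, hval, ← ofReal_norm, Complex.norm_real, Real.norm_of_nonneg hS,
    ← ENNReal.ofReal_pow hS, ← ENNReal.ofReal_mul hB,
    ENNReal.ofReal_le_ofReal_iff (by positivity)] at hsq
  nlinarith

end SumSq

end Fuchsian

theorem theorem6p1_general (Γ₀ : Subgroup PSL(2, ℝ)) (hΓ₀ : Fuchsian.IsFirstKind Γ₀) :
    ∃ C : ℝ, ∀ Γ ≤ Γ₀, ∀ k : ℕ, 0 < k → ∀ F : Set ℍ, IsFundamentalDomain Γ F volume →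
      ∀ (d : ℕ) (f : Fin d → Fuchsian.CuspForms Γ k),
        (∀ i j, Fuchsian.peterssonInner F (f i) (f j) = if i = j then 1 else 0) →
        ∀ z : ℍ, Fuchsian.sumSq f z ≤ C * (k : ℝ) ^ (3 / 2 : ℝ) := by
  obtain ⟨C, hC⟩ := Fuchsian.exists_uniformBoundAt hΓ₀
  exact ⟨C, fun Γ hΓ k hk F hF d f horth z ↦
    Fuchsian.sumSq_le horth (by positivity) (hC z Γ hΓ k hk F hF)⟩

theorem theorem6p1 (Γ₀ : Subgroup PSL(2, ℝ)) (hΓ₀ : Fuchsian.IsFirstKind Γ₀) :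
    ∃ C : ℝ, ∀ Γ : Subgroup PSL(2, ℝ), Γ ≤ Γ₀ → (Γ.subgroupOf Γ₀).FiniteIndex →
      ∀ k : ℕ, 0 < k →
      ∀ F : Set ℍ, MeasureTheory.IsFundamentalDomain Γ F MeasureTheory.volume →
      ∀ (d : ℕ) (f : Module.Basis (Fin d) ℂ (Fuchsian.CuspForms Γ k)),
        (∀ i j, Fuchsian.peterssonInner F (f i) (f j) = if i = j then 1 else 0) →
        ∀ z : ℍ, Fuchsian.sumSq f z ≤ C * (k : ℝ) ^ (3 / 2 : ℝ) := by
  obtain ⟨C, hC⟩ := theorem6p1_general Γ₀ hΓ₀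
  exact ⟨C, fun Γ hΓ _ k hk F hF d f ↦ hC Γ hΓ k hk F hF d f⟩
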